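/- Let $\alpha$ be an irrational real number with continued fraction expansion $\alpha=[a_0;a_1,a_2,\dots]$, and suppose that $a_k=O(k^d)$ for some real constant $d\ge 0$. For a positive integer $n$ let \[ A=A(n,\alpha)=\left\{\left(\{k\alpha\},\tfrac kn\right):1\le k\le n\right\}\cup\left\{\left(\{-k\alpha\},\tfrac kn\right):1\le k\le n\right\}\subset[0,1]^2, \] where $\{x\}$ denotes the fractional part of $x$; this is a set of $2n$ points. For $x,y\in[0,1]$ let $S_A(x,y)=\left|A\cap\left([0,x)\times[0,y)\right)\right|$, and let $\|x\|$ denote the distance of $x$ from the nearest integer. Then, as $n\to\infty$, \[ \int_0^1\!\!\int_0^1\left(S_A(x,y)-|A|xy\right)^2\,\mathrm dx\,\mathrm dy=\sum_{m=1}^n\frac{1}{4\pi^4m^2\|m\alpha\|^2}+O\left((\log n)^{2d}\log\log n\right), \] where the implied constant depends only on $\alpha$ and on the fixed exponent $d$. -/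

import Mathlib

open Filter Asymptotics
open scoped Topology

/-- `a_k` in the regular continued fraction expansion `α = [a₀; a₁, a₂, …]`. For irrational `α`
the expansion is infinite, so the default value `0` is never used. -/
noncomputable def partialQuotient (α : ℝ) : ℕ → ℝ
  | 0 => (GenContFract.of α).h
  | k + 1 => ((GenContFract.of α).partDens.get? k).getD 0

/-- The distance `‖x‖` of `x` from the nearest integer. -/
noncomputable def distNearestInt (x : ℝ) : ℝ := |x - round x|

/-- `S_A(x, y)`: the number of elements of `A` in the rectangle `[0, x) × [0, y)`. -/
noncomputable def boxCount (A : Finset (ℝ × ℝ)) (x y : ℝ) : ℕ :=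
  {p ∈ A | (0 ≤ p.1 ∧ p.1 < x) ∧ (0 ≤ p.2 ∧ p.2 < y)}.card

/-- The square of the (unnormalized) `L²` discrepancy of the finite set `A ⊆ [0, 1]²`. -/
noncomputable def l2DiscrepancySq (A : Finset (ℝ × ℝ)) : ℝ :=
  ∫ y in (0 : ℝ)..1, ∫ x in (0 : ℝ)..1, ((boxCount A x y : ℝ) - (A.card : ℝ) * x * y) ^ 2

/-- Davenport's symmetrized set: the points `({kα}, k/n)` and `({-kα}, k/n)`, `1 ≤ k ≤ n`. -/
noncomputable def davenportSet (n : ℕ) (α : ℝ) : Finset (ℝ × ℝ) :=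
  (Finset.Icc 1 n).image (fun k : ℕ => (Int.fract ((k : ℝ) * α), (k : ℝ) / (n : ℝ))) ∪
    (Finset.Icc 1 n).image (fun k : ℕ => (Int.fract (-((k : ℝ) * α)), (k : ℝ) / (n : ℝ)))

/-!
# The `L²` discrepancy of Davenport's symmetrized set

The symmetrization makes everything exact. At height `y` in a slab `j / n < y ≤ (j + 1) / n` the
points counted are `{±kα}` with `k ≤ j`, a set symmetric about `1/2`; integrating in `x` gives a
quadratic form in the second Bernoulli polynomial evaluated at `{(k ± l)α}`, and integrating over
the slab adds a linear term. Expanding in Fourier series, the `m`-th frequency sees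
`C = ∑ k ≤ j, cos (2πmkα)` only through `2C² + 2C = ((2C + 1)² - 1) / 2`: the square is completed
to a Dirichlet kernel. Hence (`hasSum_l2DiscrepancySq_davenportSet`) the discrepancy equals
`13/36 + ∑ m ≥ 1, A_n(mα) / (2π²m²)`, where `A_n(x)` is the average over `j < n` of
`sin² ((2j+1)πx) / sin² (πx)`.

For `m ≤ n`, `A_n(mα)` is `1 / (2π²‖mα‖²)` up to `O(1 + min (1, 1/(n‖mα‖)) / ‖mα‖²)`
(`abs_dirichletSqAverage_sub_le`), which produces the main term; for all `m` it is
`O(min (n², 1/‖mα‖²))`. The errors are controlled by one arithmetic input: with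
`L = (log n) ^ d`, one has `‖mα‖ ≫ 1 / (mL)` for `m ≤ n` (`exists_le_distNearestInt`, from
Legendre's theorem and the exponential growth of the denominators of the convergents). It makes the points
`mα` well separated over short ranges of `m`, so that sums of `1/‖mα‖²` are dominated by their
smallest terms (`sum_min_inv_sq_le`). A dyadic block `m ~ 2 ^ i` then contributes
`O(L² min (1, 2 ^ i L / n))`; only the `O(log L)` blocks with `2 ^ i ≥ n / L` matter, and this is
the source of the factor `log log n` (`sum_frequencies_le`). The tail `m > n` is `O(L²)`
(`tsum_tail_le`).
-/

/-! ### Diophantine approximation -/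

lemma not_terminatedAt_of_irrational {α : ℝ} (hα : Irrational α) (k : ℕ) :
    ¬ (GenContFract.of α).TerminatedAt k := by
  intro h
  obtain ⟨q, hq⟩ := (GenContFract.terminates_iff_rat α).1 ⟨k, h⟩
  exact hα ⟨q, hq.symm⟩

lemma dens_pos {α : ℝ} (hα : Irrational α) (k : ℕ) : 0 < (GenContFract.of α).dens k := by
  refine lt_of_lt_of_le ?_ (GenContFract.succ_nth_fib_le_of_nth_den
    (Or.inr (not_terminatedAt_of_irrational hα (k - 1))))
  exact_mod_cast Nat.fib_pos.2 k.succ_pos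

lemma exists_int_contsAux (α : ℝ) (k : ℕ) :
    ∃ A B : ℤ, (GenContFract.of α).contsAux k = ⟨(A : ℝ), (B : ℝ)⟩ := by
  induction k using Nat.twoStepInduction with
  | zero => exact ⟨1, 0, by simp⟩
  | one => exact ⟨⌊α⌋, 1, by simp⟩
  | more k ih₁ ih₂ =>
    obtain ⟨A₁, B₁, h₁⟩ := ih₁
    obtain ⟨A₂, B₂, h₂⟩ := ih₂
    rcases hs : (GenContFract.of α).s.get? k with _ | gp
    · exact ⟨A₂, B₂, by rw [GenContFract.contsAux_stable_step_of_terminated hs, h₂]⟩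
    · obtain ⟨ha, z, hz⟩ := GenContFract.of_partNum_eq_one_and_exists_int_partDen_eq hs
      refine ⟨z * A₂ + A₁, z * B₂ + B₁, ?_⟩
      rw [GenContFract.contsAux_recurrence hs h₁ h₂, ha, hz]
      push_cast
      simp

/-- The `k`-th convergent is in lowest terms, so its denominator is at most that of any fraction
representing it. -/
lemma dens_le_den_of_convs_eq {α : ℝ} (hα : Irrational α) {k : ℕ} {q : ℚ}
    (h : (GenContFract.of α).convs k = q) : (GenContFract.of α).dens k ≤ q.den := by
  obtain ⟨A, B, hAB⟩ := exists_int_contsAux α (k + 1)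
  obtain ⟨A', B', hAB'⟩ := exists_int_contsAux α (k + 2)
  have hnum : (GenContFract.of α).nums k = A := by
    rw [GenContFract.num_eq_conts_a, GenContFract.nth_cont_eq_succ_nth_contAux, hAB]
  have hden : (GenContFract.of α).dens k = B := by
    rw [GenContFract.den_eq_conts_b, GenContFract.nth_cont_eq_succ_nth_contAux, hAB]
  have hnum' : (GenContFract.of α).nums (k + 1) = A' := by
    rw [GenContFract.num_eq_conts_a, GenContFract.nth_cont_eq_succ_nth_contAux, hAB']
  have hden' : (GenContFract.of α).dens (k + 1) = B' := by
    rw [GenContFract.den_eq_conts_b, GenContFract.nth_cont_eq_succ_nth_contAux, hAB']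
  have hdet : (GenContFract.of α).nums k * (GenContFract.of α).dens (k + 1) -
      (GenContFract.of α).dens k * (GenContFract.of α).nums (k + 1) = (-1) ^ (k + 1) :=
    (SimpContFract.of α).determinant (not_terminatedAt_of_irrational hα k)
  rw [hnum, hden, hnum', hden'] at hdet
  have hdetZ : A * B' - B * A' = (-1) ^ (k + 1) := by exact_mod_cast hdet
  have hcop : IsCoprime B A := by
    refine ⟨-A' * (-1) ^ (k + 1), B' * (-1) ^ (k + 1), ?_⟩
    calc _ = (A * B' - B * A') * (-1) ^ (k + 1) := by ring
      _ = 1 := by rw [hdetZ, ← mul_pow]; simp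
  have hBpos : (0 : ℝ) < B := hden ▸ dens_pos hα k
  have hq : (0 : ℝ) < q.den := by exact_mod_cast q.den_pos
  rw [GenContFract.conv_eq_num_div_den, hnum, hden, Rat.cast_def, div_eq_div_iff hBpos.ne' hq.ne']
    at h
  have hZ : A * (q.den : ℤ) = q.num * B := by exact_mod_cast h
  have hdvd : B ∣ (q.den : ℤ) := hcop.dvd_of_dvd_mul_left ⟨q.num, by rw [hZ]; ring⟩
  have hle := Int.le_of_dvd (by exact_mod_cast q.den_pos) hdvd
  rw [hden]
  exact_mod_cast hle

/-- A convergent approximates `α` no better than the next partial quotient allows. -/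
lemma inv_le_abs_sub_convs {α : ℝ} (hα : Irrational α) (k : ℕ) :
    1 / ((partialQuotient α (k + 1) + 2) * (GenContFract.of α).dens k ^ 2) ≤
      |α - (GenContFract.of α).convs k| := by
  obtain ⟨gp, hgp⟩ : ∃ gp, (GenContFract.of α).s.get? k = some gp :=
    Option.ne_none_iff_exists'.1 (not_terminatedAt_of_irrational hα k)
  obtain ⟨ifp', hifp', hb⟩ :=
    GenContFract.IntFractPair.exists_succ_get?_stream_of_gcf_of_get?_eq_some hgp
  obtain ⟨ifp, hifp, hfr, hof⟩ := GenContFract.IntFractPair.succ_nth_stream_eq_some_iff.1 hifp'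
  have hpq : partialQuotient α (k + 1) = ⌊ifp.fr⁻¹⌋ := by
    rw [partialQuotient, GenContFract.partDen_eq_s_b hgp, Option.getD_some, ← hb, ← hof]
    rfl
  have hB : (GenContFract.of α).dens k = ((GenContFract.of α).contsAux (k + 1)).b := rfl
  have hmono : ((GenContFract.of α).contsAux k).b ≤ (GenContFract.of α).dens k := by
    rcases k with _ | k
    · simp
    · exact GenContFract.of_den_mono
  have hBpos := dens_pos hα k
  have hpB : 0 ≤ ((GenContFract.of α).contsAux k).b := GenContFract.zero_le_of_contsAux_b
  have hfrpos : 0 < ifp.fr :=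
    lt_of_le_of_ne (GenContFract.IntFractPair.nth_stream_fr_nonneg hifp) (Ne.symm hfr)
  have hsub := GenContFract.sub_convs_eq hifp
  simp only [hfr, if_false] at hsub
  rw [hsub, ← hB, abs_div, abs_pow, abs_neg, abs_one, one_pow, abs_of_pos (by positivity), hpq]
  have hinv := (Int.lt_floor_add_one ifp.fr⁻¹).le
  refine one_div_le_one_div_of_le (by positivity) ?_
  nlinarith [mul_le_mul_of_nonneg_right hinv hBpos.le]

lemma three_halves_pow_le_fib (k : ℕ) : (3 / 2 : ℝ) ^ k ≤ 2 * Nat.fib (k + 1) := by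
  induction k using Nat.twoStepInduction with
  | zero => norm_num
  | one => norm_num
  | more k ih₁ ih₂ =>
    rw [Nat.fib_add_two (n := k + 1)]
    push_cast
    have : (0 : ℝ) < (3 / 2) ^ k := by positivity
    rw [pow_succ] at ih₂ ⊢
    rw [pow_succ]
    linarith

/-- The denominators of the convergents grow exponentially. -/
lemma index_le_log_of_dens_le {α : ℝ} (hα : Irrational α) {k : ℕ} {x : ℝ}
    (h : (GenContFract.of α).dens k ≤ x) : (k : ℝ) + 1 ≤ 3 * Real.log x + 4 := by
  have hfib := (GenContFract.succ_nth_fib_le_of_nth_den (v := α) (n := k)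
      (Or.inr (not_terminatedAt_of_irrational hα (k - 1)))).trans h
  have hfpos : (0 : ℝ) < Nat.fib (k + 1) := by exact_mod_cast Nat.fib_pos.2 k.succ_pos
  have hx : 0 < x := hfpos.trans_le hfib
  have h1 : (3 / 2 : ℝ) ^ k ≤ 2 * x := (three_halves_pow_le_fib k).trans (by linarith)
  have h2 := Real.log_le_log (by positivity) h1
  rw [Real.log_pow, Real.log_mul (by norm_num) hx.ne'] at h2
  have h3 : (1 : ℝ) / 3 ≤ Real.log (3 / 2) := by
    have := Real.one_sub_inv_le_log_of_pos (show (0 : ℝ) < 3 / 2 by norm_num)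
    norm_num at this ⊢
    exact this
  have h4 := Real.log_two_lt_d9
  have h5 : (k : ℝ) * (1 / 3) ≤ k * Real.log (3 / 2) := by gcongr
  linarith

lemma distNearestInt_nonneg (x : ℝ) : 0 ≤ distNearestInt x := abs_nonneg _

lemma distNearestInt_le_abs_sub (x : ℝ) (z : ℤ) : distNearestInt x ≤ |x - z| := round_le x z

lemma distNearestInt_le_half (x : ℝ) : distNearestInt x ≤ 1 / 2 := abs_sub_round x

lemma irrational_nat_mul {α : ℝ} (hα : Irrational α) {m : ℕ} (hm : m ≠ 0) :
    Irrational ((m : ℝ) * α) := by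
  simpa [mul_comm] using hα.natCast_mul hm

lemma distNearestInt_nat_mul_pos {α : ℝ} (hα : Irrational α) {m : ℕ} (hm : m ≠ 0) :
    0 < distNearestInt (m * α) :=
  abs_pos.2 (sub_ne_zero.2 ((irrational_nat_mul hα hm).ne_int _))

/-- The growth condition on the partial quotients in Diophantine form. By Legendre's theorem an
exceptionally good approximation is a convergent `p_k / q_k`; its quality is governed by
`a_{k+1} = O((k + 1) ^ d)`, and `k = O(log q_k)`. -/
theorem exists_le_distNearestInt {α : ℝ} (hα : Irrational α) {d : ℝ} (hd : 0 ≤ d)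
    (ha : (fun k : ℕ => partialQuotient α k) =O[atTop] fun k : ℕ => (k : ℝ) ^ d) :
    ∃ c : ℝ, 0 < c ∧ c ≤ 1 ∧ ∀ n : ℕ, 3 ≤ n → ∀ m : ℕ, 1 ≤ m → m ≤ n →
      c / (m * Real.log n ^ d) ≤ distNearestInt (m * α) := by
  obtain ⟨C, hC, hbound⟩ := bound_of_isBigO_nat_atTop ha
  have h7 : (0 : ℝ) < 7 ^ d := by positivity
  refine ⟨1 / (C * 7 ^ d + 2), by positivity, ?_, fun n hn m hm hmn => ?_⟩
  · rw [div_le_one (by positivity)]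
    nlinarith [mul_pos hC h7]
  have hmpos : (0 : ℝ) < m := by exact_mod_cast hm
  have hnpos : (0 : ℝ) < n := by exact_mod_cast (by omega : 0 < n)
  have hlog : 1 ≤ Real.log n := by
    rw [Real.le_log_iff_exp_le hnpos]
    exact Real.exp_one_lt_three.le.trans (by exact_mod_cast hn)
  have hL : 1 ≤ Real.log n ^ d := Real.one_le_rpow hlog hd
  set L := Real.log n ^ d with hLdef
  -- `‖mα‖ = m |α - q|` for the fraction `q` with numerator the integer nearest to `mα`; it need
  -- not be reduced, so only `q.den ≤ m` is available.
  set q : ℚ := (round ((m : ℝ) * α) : ℚ) / m with hq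
  have hdenle : q.den ≤ m := by
    have hdvd : (q.den : ℤ) ∣ (m : ℤ) := by
      simpa only [hq, Rat.divInt_eq_div, Int.cast_natCast] using
        Rat.den_dvd (round ((m : ℝ) * α)) (m : ℤ)
    exact Nat.le_of_dvd hm (by exact_mod_cast hdvd)
  have hdenle' : (q.den : ℝ) ≤ m := by exact_mod_cast hdenle
  have hqden : (0 : ℝ) < q.den := by exact_mod_cast q.den_pos
  have hdist : distNearestInt (m * α) = m * |α - q| := by
    rw [distNearestInt, ← abs_of_pos hmpos, ← abs_mul, abs_of_pos hmpos, hq]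
    congr 1
    push_cast
    field_simp
  have hkey : ∀ X : ℝ, 0 < X → X ≤ (C * 7 ^ d + 2) * L → 1 / (X * (m : ℝ) ^ 2) ≤ |α - q| →
      1 / (C * 7 ^ d + 2) / (m * L) ≤ distNearestInt (m * α) := by
    intro X hX hXle h
    calc 1 / (C * 7 ^ d + 2) / (m * L) = 1 / (((C * 7 ^ d + 2) * L) * m) := by
          field_simp
      _ ≤ 1 / (X * m) := by gcongr
      _ = m * (1 / (X * (m : ℝ) ^ 2)) := by field_simp
      _ ≤ _ := by rw [hdist]; gcongr
  by_cases hcase : |α - q| < 1 / (2 * (q.den : ℝ) ^ 2)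
  · obtain ⟨k, hk⟩ := Real.exists_convs_eq_rat hcase
    have hdens := (dens_le_den_of_convs_eq hα hk).trans hdenle'
    have hdpos := dens_pos hα k
    have hidx := index_le_log_of_dens_le hα (hdens.trans
      (show (m : ℝ) ≤ n by exact_mod_cast hmn))
    have hk7 : (k : ℝ) + 1 ≤ 7 * Real.log n := by linarith
    have hpq : partialQuotient α (k + 1) ≤ C * 7 ^ d * L := by
      have hne : ((k + 1 : ℕ) : ℝ) ^ d ≠ 0 := by positivity
      have hb := hbound hne
      rw [Real.norm_eq_abs, Real.norm_of_nonneg (by positivity)] at hb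
      calc _ ≤ _ := (le_abs_self _).trans hb
        _ ≤ C * (7 * Real.log n) ^ d := by
          gcongr
          push_cast
          exact hk7
        _ = _ := by rw [Real.mul_rpow (by norm_num) (by linarith), hLdef]; ring
    have hpq0 : 0 ≤ partialQuotient α (k + 1) := by
      rw [partialQuotient]
      rcases h : (GenContFract.of α).partDens.get? k with _ | b
      · simp
      · simpa using zero_le_one.trans (GenContFract.of_one_le_get?_partDen h)
    refine hkey (partialQuotient α (k + 1) + 2) (by positivity) (by nlinarith) ?_
    refine le_trans ?_ (hk ▸ inv_le_abs_sub_convs hα k)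
    gcongr
  · refine hkey 2 (by norm_num) (by nlinarith [mul_pos hC h7]) ?_
    refine le_trans ?_ (not_lt.1 hcase)
    gcongr

/-! ### An exact formula for the discrepancy -/

/-- The indicator function of the half-line `(s, ∞)`. -/
noncomputable def halfLineIndicator (s x : ℝ) : ℝ := if s < x then 1 else 0

/-- The number of elements of the pair `s`, `1 - s` that are less than `x`. -/
noncomputable def reflectedPairCount (s x : ℝ) : ℝ :=
  halfLineIndicator s x + halfLineIndicator (1 - s) x

/-- The second Bernoulli polynomial as a real function. -/
noncomputable def bernoulliTwo (x : ℝ) : ℝ := x ^ 2 - x + 1 / 6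

lemma halfLineIndicator_mul (s t x : ℝ) :
    halfLineIndicator s x * halfLineIndicator t x = halfLineIndicator (max s t) x := by
  simp only [halfLineIndicator, max_lt_iff]
  split_ifs <;> simp_all

lemma halfLineIndicator_mul_eq_sub (s : ℝ) (g : ℝ → ℝ) :
    (fun x => halfLineIndicator s x * g x) = fun x => g x - {x | x ≤ s}.indicator g x := by
  funext x
  by_cases h : s < x
  · simp [halfLineIndicator, h, Set.indicator, not_le.2 h]
  · simp [halfLineIndicator, h, Set.indicator, not_lt.1 h]

lemma intervalIntegrable_halfLineIndicator_mul (s : ℝ) {g : ℝ → ℝ} (hg : Continuous g) (a b : ℝ) :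
    IntervalIntegrable (fun x => halfLineIndicator s x * g x) MeasureTheory.volume a b := by
  rw [halfLineIndicator_mul_eq_sub]
  refine (hg.intervalIntegrable a b).sub ?_
  have h := hg.intervalIntegrable (μ := MeasureTheory.volume) a b
  rw [intervalIntegrable_iff] at h ⊢
  exact h.indicator measurableSet_Iic

lemma integral_halfLineIndicator_mul {s : ℝ} (hs : s ∈ Set.Icc (0 : ℝ) 1) {g : ℝ → ℝ}
    (hg : Continuous g) :
    ∫ x in (0 : ℝ)..1, halfLineIndicator s x * g x = ∫ x in s..1, g x := by
  have h := hg.intervalIntegrable (μ := MeasureTheory.volume) 0 1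
  have h' : IntervalIntegrable ({x | x ≤ s}.indicator g) MeasureTheory.volume 0 1 := by
    rw [intervalIntegrable_iff] at h ⊢
    exact h.indicator measurableSet_Iic
  rw [halfLineIndicator_mul_eq_sub, intervalIntegral.integral_sub h h',
    intervalIntegral.integral_indicator hs,
    intervalIntegral.integral_interval_sub_left h (hg.intervalIntegrable _ _)]

lemma intervalIntegrable_halfLineIndicator (s a b : ℝ) :
    IntervalIntegrable (halfLineIndicator s) MeasureTheory.volume a b := by
  simpa using intervalIntegrable_halfLineIndicator_mul s (continuous_const (y := (1 : ℝ))) a b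

lemma integral_halfLineIndicator {s : ℝ} (hs : s ∈ Set.Icc (0 : ℝ) 1) :
    ∫ x in (0 : ℝ)..1, halfLineIndicator s x = 1 - s := by
  simpa using integral_halfLineIndicator_mul hs (continuous_const (y := (1 : ℝ)))

lemma reflectedPairCount_mul (s t x : ℝ) :
    reflectedPairCount s x * reflectedPairCount t x =
      halfLineIndicator (max s t) x + halfLineIndicator (max s (1 - t)) x +
        (halfLineIndicator (max (1 - s) t) x + halfLineIndicator (max (1 - s) (1 - t)) x) := by
  simp only [reflectedPairCount, ← halfLineIndicator_mul]
  ring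

lemma intervalIntegrable_fun_sum {ι : Type*} (F : Finset ι) {f : ι → ℝ → ℝ} {a b : ℝ}
    (h : ∀ k, IntervalIntegrable (f k) MeasureTheory.volume a b) :
    IntervalIntegrable (fun x => ∑ k ∈ F, f k x) MeasureTheory.volume a b := by
  have := IntervalIntegrable.sum F fun k _ => h k
  rwa [Finset.sum_fn] at this

lemma intervalIntegrable_reflectedPairCount_mul (s t a b : ℝ) :
    IntervalIntegrable (fun x => reflectedPairCount s x * reflectedPairCount t x)
      MeasureTheory.volume a b := by
  simp only [reflectedPairCount_mul]
  exact ((intervalIntegrable_halfLineIndicator _ _ _).add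
    (intervalIntegrable_halfLineIndicator _ _ _)).add
      ((intervalIntegrable_halfLineIndicator _ _ _).add
        (intervalIntegrable_halfLineIndicator _ _ _))

lemma integral_reflectedPairCount_mul {s t : ℝ} (hs : s ∈ Set.Icc (0 : ℝ) 1)
    (ht : t ∈ Set.Icc (0 : ℝ) 1) :
    ∫ x in (0 : ℝ)..1, reflectedPairCount s x * reflectedPairCount t x =
      bernoulliTwo |s - t| + bernoulliTwo |s + t - 1| - 2 * bernoulliTwo s - 2 * bernoulliTwo t
        + 4 / 3 := by
  have hs' : 1 - s ∈ Set.Icc (0 : ℝ) 1 := ⟨by linarith [hs.2], by linarith [hs.1]⟩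
  have ht' : 1 - t ∈ Set.Icc (0 : ℝ) 1 := ⟨by linarith [ht.2], by linarith [ht.1]⟩
  have hmax : ∀ {u v : ℝ}, u ∈ Set.Icc (0 : ℝ) 1 → v ∈ Set.Icc (0 : ℝ) 1 →
      max u v ∈ Set.Icc (0 : ℝ) 1 := fun hu hv => ⟨le_max_of_le_left hu.1, max_le hu.2 hv.2⟩
  have hi := fun u => intervalIntegrable_halfLineIndicator u 0 1
  simp only [reflectedPairCount_mul]
  rw [intervalIntegral.integral_add ((hi _).add (hi _)) ((hi _).add (hi _)),
    intervalIntegral.integral_add (hi _) (hi _), intervalIntegral.integral_add (hi _) (hi _),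
    integral_halfLineIndicator (hmax hs ht), integral_halfLineIndicator (hmax hs ht'),
    integral_halfLineIndicator (hmax hs' ht), integral_halfLineIndicator (hmax hs' ht')]
  have hmax' : ∀ u v : ℝ, max u v = (u + v + |u - v|) / 2 := by
    intro u v
    rcases le_total u v with h | h
    · rw [max_eq_right h, abs_of_nonpos (by linarith)]
      ring
    · rw [max_eq_left h, abs_of_nonneg (by linarith)]
      ring
  simp only [hmax']
  rw [show s - (1 - t) = s + t - 1 by ring, show 1 - s - t = -(s + t - 1) by ring,
    show 1 - s - (1 - t) = -(s - t) by ring, abs_neg, abs_neg]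
  simp only [bernoulliTwo, sq_abs]
  ring

lemma integral_mul_reflectedPairCount {s : ℝ} (hs : s ∈ Set.Icc (0 : ℝ) 1) :
    ∫ x in (0 : ℝ)..1, reflectedPairCount s x * x = 2 / 3 - bernoulliTwo s := by
  have hs' : 1 - s ∈ Set.Icc (0 : ℝ) 1 := ⟨by linarith [hs.2], by linarith [hs.1]⟩
  have hi := fun u => intervalIntegrable_halfLineIndicator_mul u continuous_id 0 1
  simp only [id] at hi
  simp only [reflectedPairCount, add_mul]
  rw [intervalIntegral.integral_add (hi _) (hi _), integral_halfLineIndicator_mul hs continuous_id',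
    integral_halfLineIndicator_mul hs' continuous_id', integral_id, integral_id]
  simp only [bernoulliTwo]
  ring

/-- The mean square over `x` of the discrepancy function of a set of points symmetric about `1/2`,
in terms of the second Bernoulli polynomial. -/
lemma integral_sum_reflectedPairCount_sub_sq {ι : Type*} (F : Finset ι) (s : ι → ℝ)
    (hs : ∀ k, s k ∈ Set.Icc (0 : ℝ) 1) (c : ℝ) :
    ∫ x in (0 : ℝ)..1, (∑ k ∈ F, reflectedPairCount (s k) x - c * x) ^ 2 =
      ∑ k ∈ F, ∑ l ∈ F, (bernoulliTwo |s k - s l| + bernoulliTwo |s k + s l - 1|) +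
        (2 * c - 4 * F.card) * ∑ k ∈ F, bernoulliTwo (s k) + (c - 2 * F.card) ^ 2 / 3 := by
  have hexp : ∀ x, (∑ k ∈ F, reflectedPairCount (s k) x - c * x) ^ 2 =
      ∑ k ∈ F, ∑ l ∈ F, reflectedPairCount (s k) x * reflectedPairCount (s l) x -
        2 * c * ∑ k ∈ F, reflectedPairCount (s k) x * x + c ^ 2 * x ^ 2 := by
    intro x
    rw [← Finset.sum_mul_sum, ← Finset.sum_mul]
    ring
  have h2 : ∀ k, IntervalIntegrable (fun x => reflectedPairCount (s k) x * x)
      MeasureTheory.volume 0 1 := by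
    intro k
    simp only [reflectedPairCount, add_mul]
    exact (intervalIntegrable_halfLineIndicator_mul _ continuous_id' _ _).add
      (intervalIntegrable_halfLineIndicator_mul _ continuous_id' _ _)
  have h1' : IntervalIntegrable
      (fun x => ∑ k ∈ F, ∑ l ∈ F, reflectedPairCount (s k) x * reflectedPairCount (s l) x)
      MeasureTheory.volume 0 1 := by
    exact intervalIntegrable_fun_sum F fun k => intervalIntegrable_fun_sum F fun l =>
      intervalIntegrable_reflectedPairCount_mul (s k) (s l) 0 1
  have h2' : IntervalIntegrable (fun x => 2 * c * ∑ k ∈ F, reflectedPairCount (s k) x * x)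
      MeasureTheory.volume 0 1 := by
    exact (intervalIntegrable_fun_sum F h2).const_mul _
  have h3' : IntervalIntegrable (fun x : ℝ => c ^ 2 * x ^ 2) MeasureTheory.volume 0 1 :=
    Continuous.intervalIntegrable (by fun_prop) _ _
  simp only [hexp]
  rw [intervalIntegral.integral_add (h1'.sub h2') h3', intervalIntegral.integral_sub h1' h2',
    intervalIntegral.integral_const_mul, intervalIntegral.integral_const_mul,
    intervalIntegral.integral_finsetSum (fun k _ => h2 k), integral_pow,
    intervalIntegral.integral_finsetSum (fun k _ => intervalIntegrable_fun_sum F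
      fun l => intervalIntegrable_reflectedPairCount_mul (s k) (s l) 0 1)]
  have h4 : ∀ k ∈ F,
      (∫ x in (0 : ℝ)..1, ∑ l ∈ F, reflectedPairCount (s k) x * reflectedPairCount (s l) x) =
      ∑ l ∈ F, (bernoulliTwo |s k - s l| + bernoulliTwo |s k + s l - 1| - 2 * bernoulliTwo (s k)
        - 2 * bernoulliTwo (s l) + 4 / 3) := by
    intro k _
    rw [intervalIntegral.integral_finsetSum
      (fun l _ => intervalIntegrable_reflectedPairCount_mul (s k) (s l) 0 1)]
    exact Finset.sum_congr rfl fun l _ => integral_reflectedPairCount_mul (hs k) (hs l)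
  rw [Finset.sum_congr rfl h4,
    Finset.sum_congr rfl (fun k _ => integral_mul_reflectedPairCount (hs k))]
  simp only [Finset.sum_add_distrib, Finset.sum_sub_distrib, Finset.sum_const, nsmul_eq_mul,
    ← Finset.mul_sum]
  norm_num
  ring

lemma fract_neg_nat_mul {α : ℝ} (hα : Irrational α) {k : ℕ} (hk : k ≠ 0) :
    Int.fract (-((k : ℝ) * α)) = 1 - Int.fract ((k : ℝ) * α) := by
  refine Int.fract_neg fun h => ?_
  have h' := Int.floor_add_fract ((k : ℝ) * α)
  rw [h, add_zero] at h'
  exact (irrational_nat_mul hα hk).ne_int _ h'.symm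

lemma disjoint_davenportSet {α : ℝ} (hα : Irrational α) {n : ℕ} (hn : n ≠ 0) :
    Disjoint
      ((Finset.Icc 1 n).image (fun k : ℕ => (Int.fract ((k : ℝ) * α), (k : ℝ) / (n : ℝ))))
      ((Finset.Icc 1 n).image
        (fun k : ℕ => (Int.fract (-((k : ℝ) * α)), (k : ℝ) / (n : ℝ)))) := by
  have hn' : (n : ℝ) ≠ 0 := by exact_mod_cast hn
  rw [Finset.disjoint_left]
  intro p hp hp'
  obtain ⟨k, hk, rfl⟩ := Finset.mem_image.1 hp
  obtain ⟨l, hl, h⟩ := Finset.mem_image.1 hp'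
  rw [Prod.mk.injEq] at h
  obtain ⟨h1, h2⟩ := h
  rw [div_left_inj' hn'] at h2
  have hlk : l = k := by exact_mod_cast h2
  subst hlk
  obtain ⟨z, hz⟩ := Int.fract_eq_fract.1 h1
  have hl0 : 2 * l ≠ 0 := by have := (Finset.mem_Icc.1 hl).1; omega
  refine (irrational_nat_mul hα hl0).ne_int (-z) ?_
  push_cast
  linarith

lemma injOn_prodMk_div {n : ℕ} (hn : n ≠ 0) (f : ℕ → ℝ) (S : Set ℕ) :
    Set.InjOn (fun k : ℕ => (f k, (k : ℝ) / (n : ℝ))) S := by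
  have hn' : (n : ℝ) ≠ 0 := by exact_mod_cast hn
  intro k _ l _ h
  rw [Prod.mk.injEq, div_left_inj' hn'] at h
  exact_mod_cast h.2

lemma card_davenportSet {α : ℝ} (hα : Irrational α) {n : ℕ} (hn : n ≠ 0) :
    (davenportSet n α).card = 2 * n := by
  rw [davenportSet, Finset.card_union_of_disjoint (disjoint_davenportSet hα hn),
    Finset.card_image_of_injOn (injOn_prodMk_div hn _ _),
    Finset.card_image_of_injOn (injOn_prodMk_div hn _ _), Nat.card_Icc]
  omega

lemma card_filter_image_div {n j : ℕ} (hn : n ≠ 0) (hj : j < n) {f : ℕ → ℝ} (hf : ∀ k, 0 ≤ f k)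
    {x y : ℝ} (hy : (j : ℝ) / n < y) (hy' : y ≤ (j + 1) / n) :
    ((({p ∈ (Finset.Icc 1 n).image (fun k : ℕ => (f k, (k : ℝ) / (n : ℝ))) |
      (0 ≤ p.1 ∧ p.1 < x) ∧ (0 ≤ p.2 ∧ p.2 < y)}).card : ℕ) : ℝ) =
      ∑ k ∈ Finset.Icc 1 j, halfLineIndicator (f k) x := by
  have hnpos : (0 : ℝ) < n := by exact_mod_cast Nat.pos_of_ne_zero hn
  rw [Finset.filter_image, Finset.card_image_of_injOn (injOn_prodMk_div hn _ _)]
  simp only [halfLineIndicator, Finset.sum_boole]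
  congr 2
  ext k
  simp only [Finset.mem_filter, Finset.mem_Icc, hf, true_and]
  have hk0 : 0 ≤ (k : ℝ) / n := by positivity
  constructor
  · rintro ⟨⟨h1, -⟩, h2, -, h3⟩
    have h4 := h3.trans_le hy'
    rw [div_lt_div_iff_of_pos_right hnpos] at h4
    have h5 : k < j + 1 := by exact_mod_cast h4
    exact ⟨⟨h1, by omega⟩, h2⟩
  · rintro ⟨⟨h1, h2⟩, h3⟩
    refine ⟨⟨h1, by omega⟩, h3, hk0, lt_of_le_of_lt ?_ hy⟩
    gcongr

lemma boxCount_davenportSet {α : ℝ} (hα : Irrational α) {n j : ℕ} (hj : j < n) {x y : ℝ}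
    (hy : (j : ℝ) / n < y) (hy' : y ≤ (j + 1) / n) :
    (boxCount (davenportSet n α) x y : ℝ) =
      ∑ k ∈ Finset.Icc 1 j, reflectedPairCount (Int.fract ((k : ℝ) * α)) x := by
  have hn : n ≠ 0 := by omega
  rw [boxCount, davenportSet, Finset.filter_union, Finset.card_union_of_disjoint
    (Finset.disjoint_filter_filter (disjoint_davenportSet hα hn)), Nat.cast_add,
    card_filter_image_div hn hj (fun _ => Int.fract_nonneg _) hy hy',
    card_filter_image_div hn hj (fun _ => Int.fract_nonneg _) hy hy', ← Finset.sum_add_distrib]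
  refine Finset.sum_congr rfl fun k hk => ?_
  rw [reflectedPairCount, fract_neg_nat_mul hα (by have := (Finset.mem_Icc.1 hk).1; omega)]

lemma integral_quadratic_slab {n j : ℕ} (hn : n ≠ 0) (W B : ℝ) :
    ∫ y in ((j : ℝ) / n)..((j + 1 : ℕ) : ℝ) / n,
      (W + (2 * (2 * n * y) - 4 * j) * B + (2 * n * y - 2 * j) ^ 2 / 3) =
      (W + 2 * B + 4 / 9) / n := by
  have hn' : (n : ℝ) ≠ 0 := by exact_mod_cast hn
  have hderiv : ∀ y : ℝ, HasDerivAt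
      (fun y : ℝ => W * y + 2 * B / n * (n * y - j) ^ 2 + 4 / 9 / n * (n * y - j) ^ 3)
      (W + (2 * (2 * n * y) - 4 * j) * B + (2 * n * y - 2 * j) ^ 2 / 3) y := by
    intro y
    have h1 : HasDerivAt (fun y : ℝ => (n : ℝ) * y - j) n y := by
      simpa using ((hasDerivAt_id y).const_mul (n : ℝ)).sub_const (j : ℝ)
    have h2 := (((hasDerivAt_id y).const_mul W).add ((h1.pow 2).const_mul (2 * B / n))).add
      ((h1.pow 3).const_mul (4 / 9 / (n : ℝ)))
    convert! h2 using 1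
    simp
    field_simp
    ring
  rw [intervalIntegral.integral_eq_sub_of_hasDerivAt (fun y _ => hderiv y)
    (Continuous.intervalIntegrable (by fun_prop) _ _)]
  push_cast
  field_simp
  ring

/-- The discrepancy as a finite sum, obtained by integrating over the horizontal slabs
`j / n < y ≤ (j + 1) / n`, in which the points below height `y` are those with `k ≤ j`. -/
lemma l2DiscrepancySq_davenportSet {α : ℝ} (hα : Irrational α) {n : ℕ} (hn : n ≠ 0) :
    l2DiscrepancySq (davenportSet n α) =
      ∑ j ∈ Finset.range n, (∑ k ∈ Finset.Icc 1 j, ∑ l ∈ Finset.Icc 1 j,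
        (bernoulliTwo |Int.fract ((k : ℝ) * α) - Int.fract ((l : ℝ) * α)| +
          bernoulliTwo |Int.fract ((k : ℝ) * α) + Int.fract ((l : ℝ) * α) - 1|) +
        2 * ∑ k ∈ Finset.Icc 1 j, bernoulliTwo (Int.fract ((k : ℝ) * α)) + 4 / 9) / n := by
  have hn' : (n : ℝ) ≠ 0 := by exact_mod_cast hn
  have hnpos : (0 : ℝ) < n := by exact_mod_cast Nat.pos_of_ne_zero hn
  set W : ℕ → ℝ := fun j => ∑ k ∈ Finset.Icc 1 j, ∑ l ∈ Finset.Icc 1 j,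
        (bernoulliTwo |Int.fract ((k : ℝ) * α) - Int.fract ((l : ℝ) * α)| +
          bernoulliTwo |Int.fract ((k : ℝ) * α) + Int.fract ((l : ℝ) * α) - 1|) with hW
  set B : ℕ → ℝ := fun j => ∑ k ∈ Finset.Icc 1 j, bernoulliTwo (Int.fract ((k : ℝ) * α)) with hB
  set f : ℝ → ℝ := fun y => ∫ x in (0 : ℝ)..1,
    ((boxCount (davenportSet n α) x y : ℝ) - ((davenportSet n α).card : ℝ) * x * y) ^ 2 with hf
  have hslab : ∀ j < n, ∀ y ∈ Set.uIoc ((j : ℝ) / n) (((j + 1 : ℕ) : ℝ) / n),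
      (W j + (2 * (2 * n * y) - 4 * j) * B j + (2 * n * y - 2 * j) ^ 2 / 3) = f y := by
    intro j hj y hy
    have hle : (j : ℝ) / n ≤ ((j + 1 : ℕ) : ℝ) / n := by
      gcongr
      exact Nat.le_succ j
    rw [Set.uIoc_of_le hle] at hy
    have hint := integral_sum_reflectedPairCount_sub_sq (Finset.Icc 1 j)
      (fun k => Int.fract ((k : ℝ) * α))
      (fun k => ⟨Int.fract_nonneg _, (Int.fract_lt_one _).le⟩) (2 * n * y)
    rw [Nat.card_Icc, Nat.add_sub_cancel] at hint
    rw [← hint]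
    refine intervalIntegral.integral_congr fun x _ => ?_
    have hbox := boxCount_davenportSet hα (x := x) hj hy.1 (by simpa using hy.2)
    simp only [hbox, card_davenportSet hα hn]
    push_cast
    ring
  have hint : ∀ j < n, IntervalIntegrable f MeasureTheory.volume ((j : ℝ) / n)
      (((j + 1 : ℕ) : ℝ) / n) := fun j hj =>
    (Continuous.intervalIntegrable (u := fun y : ℝ =>
      W j + (2 * (2 * n * y) - 4 * j) * B j + (2 * n * y - 2 * j) ^ 2 / 3)
      (by fun_prop) _ _).congr (hslab j hj)
  have hsum := intervalIntegral.sum_integral_adjacent_intervals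
    (a := fun j : ℕ => (j : ℝ) / n) hint
  simp only [Nat.cast_zero, zero_div, div_self hn'] at hsum
  rw [l2DiscrepancySq, ← hsum]
  refine Finset.sum_congr rfl fun j hj => ?_
  rw [← integral_quadratic_slab hn]
  exact (intervalIntegral.integral_congr_ae
    (Eventually.of_forall (hslab j (Finset.mem_range.1 hj)))).symm

lemma hasSum_bernoulliTwo {x : ℝ} (hx : x ∈ Set.Icc (0 : ℝ) 1) :
    HasSum (fun m : ℕ => 1 / (Real.pi ^ 2 * (m : ℝ) ^ 2) * Real.cos (2 * Real.pi * m * x))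
      (bernoulliTwo x) := by
  have h := (hasSum_one_div_nat_pow_mul_cos one_ne_zero hx).mul_left (1 / Real.pi ^ 2)
  have hpi : Real.pi ≠ 0 := Real.pi_ne_zero
  convert! h using 1
  · funext m
    rw [← mul_assoc]
    congr 1
    rw [mul_one, div_mul_div_comm, one_mul]
  · have : (Polynomial.map (algebraMap ℚ ℝ) (Polynomial.bernoulli (2 * 1))).eval x =
        bernoulliTwo x := by
      simp [Polynomial.bernoulli_def, Finset.sum_range_succ, bernoulliTwo, bernoulli_two,
        bernoulli_one]
      ring
    rw [this]
    norm_num [Nat.factorial]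
    field_simp

lemma cos_two_pi_mul_fract (m : ℕ) (x : ℝ) :
    Real.cos (2 * Real.pi * m * Int.fract x) = Real.cos (2 * Real.pi * m * x) := by
  rw [← Real.cos_sub_int_mul_two_pi (2 * Real.pi * m * x) (m * ⌊x⌋), Int.fract]
  congr 1
  push_cast
  ring

lemma cos_mul_abs (a x : ℝ) : Real.cos (a * |x|) = Real.cos (a * x) := by
  rcases abs_choice x with h | h
  · rw [h]
  · rw [h, mul_neg, Real.cos_neg]

/-- Expanding the Bernoulli polynomials into Fourier series diagonalizes the quadratic form, and
the linear terms complete the square to a Dirichlet kernel. -/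
theorem hasSum_l2DiscrepancySq_davenportSet {α : ℝ} (hα : Irrational α) {n : ℕ} (hn : n ≠ 0) :
    HasSum (fun m : ℕ => 1 / (2 * Real.pi ^ 2 * (m : ℝ) ^ 2) * ((∑ j ∈ Finset.range n,
        (2 * ∑ k ∈ Finset.Icc 1 j, Real.cos (2 * Real.pi * m * (k * α)) + 1) ^ 2) / n))
      (l2DiscrepancySq (davenportSet n α) - 13 / 36) := by
  have hn' : (n : ℝ) ≠ 0 := by exact_mod_cast hn
  have hpi : Real.pi ≠ 0 := Real.pi_ne_zero
  set s : ℕ → ℝ := fun k => Int.fract ((k : ℝ) * α) with hs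
  have hs0 : ∀ k, 0 ≤ s k := fun k => Int.fract_nonneg _
  have hs1 : ∀ k, s k < 1 := fun k => Int.fract_lt_one _
  have hj : ∀ j : ℕ, HasSum (fun m : ℕ => (∑ k ∈ Finset.Icc 1 j, ∑ l ∈ Finset.Icc 1 j,
      (1 / (Real.pi ^ 2 * (m : ℝ) ^ 2) * Real.cos (2 * Real.pi * m * |s k - s l|) +
        1 / (Real.pi ^ 2 * (m : ℝ) ^ 2) * Real.cos (2 * Real.pi * m * |s k + s l - 1|)) +
      2 * ∑ k ∈ Finset.Icc 1 j,
        1 / (Real.pi ^ 2 * (m : ℝ) ^ 2) * Real.cos (2 * Real.pi * m * s k) +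
      1 / (2 * Real.pi ^ 2) * (1 / (m : ℝ) ^ 2)) / n)
      ((∑ k ∈ Finset.Icc 1 j, ∑ l ∈ Finset.Icc 1 j,
        (bernoulliTwo |s k - s l| + bernoulliTwo |s k + s l - 1|) +
        2 * ∑ k ∈ Finset.Icc 1 j, bernoulliTwo (s k) +
        1 / (2 * Real.pi ^ 2) * (Real.pi ^ 2 / 6)) / n) := by
    intro j
    refine HasSum.div_const (((hasSum_sum fun k _ => hasSum_sum fun l _ =>
      (hasSum_bernoulliTwo ?_).add (hasSum_bernoulliTwo ?_)).add
      ((hasSum_sum fun k _ => hasSum_bernoulliTwo ⟨hs0 k, (hs1 k).le⟩).mul_left 2)).add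
      (hasSum_zeta_two.mul_left _)) _
    · exact ⟨abs_nonneg _, abs_le.2 ⟨by linarith [hs0 k, hs1 l], by linarith [hs0 l, hs1 k]⟩⟩
    · exact ⟨abs_nonneg _, abs_le.2 ⟨by linarith [hs0 k, hs0 l], by linarith [hs1 l, hs1 k]⟩⟩
  have htot := hasSum_sum (s := Finset.range n) fun j _ => hj j
  convert! htot using 1
  · funext m
    rw [← Finset.sum_div, mul_div_assoc', Finset.mul_sum]
    congr 1
    refine Finset.sum_congr rfl fun j _ => ?_
    set C := ∑ k ∈ Finset.Icc 1 j, Real.cos (2 * Real.pi * m * (k * α)) with hC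
    have h1 : ∑ k ∈ Finset.Icc 1 j,
        1 / (Real.pi ^ 2 * (m : ℝ) ^ 2) * Real.cos (2 * Real.pi * m * s k) =
        1 / (Real.pi ^ 2 * (m : ℝ) ^ 2) * C := by
      rw [hC, Finset.mul_sum]
      exact Finset.sum_congr rfl fun k _ => by rw [hs, cos_two_pi_mul_fract]
    have h2 : ∑ k ∈ Finset.Icc 1 j, ∑ l ∈ Finset.Icc 1 j,
        (1 / (Real.pi ^ 2 * (m : ℝ) ^ 2) * Real.cos (2 * Real.pi * m * |s k - s l|) +
          1 / (Real.pi ^ 2 * (m : ℝ) ^ 2) * Real.cos (2 * Real.pi * m * |s k + s l - 1|)) =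
        1 / (Real.pi ^ 2 * (m : ℝ) ^ 2) * (2 * (C * C)) := by
      rw [hC, Finset.sum_mul_sum, Finset.mul_sum, Finset.mul_sum]
      refine Finset.sum_congr rfl fun k _ => ?_
      rw [Finset.mul_sum, Finset.mul_sum]
      refine Finset.sum_congr rfl fun l _ => ?_
      have h3 : Real.cos (2 * Real.pi * m * (s k + s l - 1)) =
          Real.cos (2 * Real.pi * m * s k + 2 * Real.pi * m * s l) := by
        rw [← Real.cos_sub_nat_mul_two_pi (2 * Real.pi * m * s k + 2 * Real.pi * m * s l) m]
        congr 1
        ring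
      rw [cos_mul_abs, cos_mul_abs, h3, mul_sub, Real.cos_sub, Real.cos_add,
        ← cos_two_pi_mul_fract m (k * α), ← cos_two_pi_mul_fract m (l * α)]
      ring
    rw [h1, h2]
    rcases Nat.eq_zero_or_pos m with rfl | hm
    · simp
    · have hm' : (m : ℝ) ≠ 0 := by exact_mod_cast hm.ne'
      field_simp
      ring
  · rw [l2DiscrepancySq_davenportSet hα hn, ← Finset.sum_div, ← Finset.sum_div,
      Finset.sum_add_distrib, Finset.sum_add_distrib (g := fun _ => 1 / (2 * Real.pi ^ 2) * _),
      Finset.sum_const, Finset.sum_const, Finset.card_range]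
    have hzeta : 1 / (2 * Real.pi ^ 2) * (Real.pi ^ 2 / 6) = 1 / 12 := by
      field_simp
      norm_num
    rw [hzeta, add_div, add_div _ (n • (1 / 12 : ℝ)), nsmul_eq_mul, nsmul_eq_mul,
      mul_div_cancel_left₀ _ hn', mul_div_cancel_left₀ _ hn']
    simp only [hs]
    linarith

/-! ### Averages of squared Dirichlet kernels -/

/-- The average over `j < n` of the squares of the Dirichlet kernels
`1 + 2 ∑ k ≤ j, cos (2πkx)`. -/
noncomputable def dirichletSqAverage (n : ℕ) (x : ℝ) : ℝ :=
  (∑ j ∈ Finset.range n,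
    (2 * ∑ k ∈ Finset.Icc 1 j, Real.cos (2 * Real.pi * k * x) + 1) ^ 2) / n

lemma dirichletSqAverage_nonneg (n : ℕ) (x : ℝ) : 0 ≤ dirichletSqAverage n x := by
  unfold dirichletSqAverage
  positivity

lemma dirichletKernel_mul_sin (j : ℕ) (x : ℝ) :
    (2 * ∑ k ∈ Finset.Icc 1 j, Real.cos (2 * Real.pi * k * x) + 1) * Real.sin (Real.pi * x) =
      Real.sin ((2 * j + 1) * (Real.pi * x)) := by
  induction j with
  | zero => simp
  | succ j ih =>
    rw [Finset.sum_Icc_succ_top (by omega)]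
    have h1 : Real.sin ((2 * (j + 1 : ℕ) + 1) * (Real.pi * x)) =
        Real.sin (2 * Real.pi * (j + 1 : ℕ) * x + Real.pi * x) := by
      congr 1
      ring
    have h2 : Real.sin ((2 * j + 1) * (Real.pi * x)) =
        Real.sin (2 * Real.pi * (j + 1 : ℕ) * x - Real.pi * x) := by
      congr 1
      push_cast
      ring
    rw [h2, Real.sin_sub] at ih
    rw [h1, Real.sin_add]
    linarith

lemma two_sin_mul_sum_cos (n : ℕ) (y : ℝ) :
    2 * Real.sin y * ∑ j ∈ Finset.range n, Real.cos ((2 * j + 1) * y) =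
      Real.sin (2 * n * y) := by
  induction n with
  | zero => simp
  | succ n ih =>
    rw [Finset.sum_range_succ, mul_add, ih]
    have h1 : Real.sin (2 * (n + 1 : ℕ) * y) = Real.sin ((2 * n + 1) * y + y) := by
      congr 1
      push_cast
      ring
    have h2 : Real.sin (2 * n * y) = Real.sin ((2 * n + 1) * y - y) := by
      congr 1
      ring
    rw [h1, h2, Real.sin_add, Real.sin_sub]
    ring

lemma two_mul_le_sin_pi_mul {x : ℝ} (h0 : 0 ≤ x) (h1 : x ≤ 1 / 2) :
    2 * x ≤ Real.sin (Real.pi * x) := by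
  have h := Real.mul_le_sin (x := Real.pi * x) (by positivity) (by nlinarith [Real.pi_pos])
  calc 2 * x = 2 / Real.pi * (Real.pi * x) := by field_simp
    _ ≤ _ := h

lemma dirichletSqAverage_le_sq (n : ℕ) (x : ℝ) : dirichletSqAverage n x ≤ 4 * (n : ℝ) ^ 2 := by
  have hterm : ∀ j ∈ Finset.range n,
      (2 * ∑ k ∈ Finset.Icc 1 j, Real.cos (2 * Real.pi * k * x) + 1) ^ 2 ≤ 4 * (n : ℝ) ^ 2 := by
    intro j hj
    have hjn : (j : ℝ) + 1 ≤ n := by exact_mod_cast Finset.mem_range.1 hj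
    have habs : |∑ k ∈ Finset.Icc 1 j, Real.cos (2 * Real.pi * k * x)| ≤ j := by
      refine (Finset.abs_sum_le_sum_abs _ _).trans ?_
      refine (Finset.sum_le_card_nsmul (Finset.Icc 1 j) _ 1
        fun k _ => Real.abs_cos_le_one _).trans ?_
      simp
    rw [abs_le] at habs
    nlinarith
  have h := Finset.sum_le_sum hterm
  rw [Finset.sum_const, Finset.card_range, nsmul_eq_mul] at h
  exact div_le_of_le_mul₀ (Nat.cast_nonneg n) (by positivity) (by linarith)

lemma dirichletSqAverage_eq (n : ℕ) {x : ℝ} (hs : Real.sin (Real.pi * x) ≠ 0) :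
    dirichletSqAverage n x =
      (∑ j ∈ Finset.range n, Real.sin ((2 * j + 1) * (Real.pi * x)) ^ 2) / n /
        Real.sin (Real.pi * x) ^ 2 := by
  simp only [← dirichletKernel_mul_sin, mul_pow]
  rw [← Finset.sum_mul, mul_div_right_comm, mul_div_cancel_right₀ _ (pow_ne_zero 2 hs),
    dirichletSqAverage]

lemma dirichletSqAverage_le_inv_sq (n : ℕ) {x : ℝ} (h0 : 0 < x) (h1 : x ≤ 1 / 2) :
    dirichletSqAverage n x ≤ 1 / (4 * x ^ 2) := by
  have hs := two_mul_le_sin_pi_mul h0.le h1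
  have hspos : 0 < Real.sin (Real.pi * x) := by linarith
  rw [dirichletSqAverage_eq n hspos.ne']
  have h2 : (∑ j ∈ Finset.range n, Real.sin ((2 * j + 1) * (Real.pi * x)) ^ 2) / n ≤ 1 := by
    refine div_le_one_of_le₀ ?_ (Nat.cast_nonneg n)
    refine (Finset.sum_le_card_nsmul _ _ 1 fun j _ => Real.sin_sq_le_one _).trans ?_
    simp
  refine div_le_div₀ zero_le_one h2 (by positivity) ?_
  nlinarith

lemma inv_sin_sq_sub_inv_sq_le_one {y : ℝ} (h0 : 0 < y) (h1 : y ≤ Real.pi / 2) :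
    1 / Real.sin y ^ 2 - 1 / y ^ 2 ≤ 1 := by
  have hs : 0 < Real.sin y := Real.sin_pos_of_pos_of_lt_pi h0 (by linarith [Real.pi_pos])
  have hcos : 0 ≤ Real.cos y := Real.cos_nonneg_of_mem_Icc ⟨by linarith, h1⟩
  have hle : y * Real.cos y ≤ Real.sin y := by
    rcases h1.eq_or_lt with rfl | h
    · simp
    · have hc : 0 < Real.cos y := Real.cos_pos_of_mem_Ioo ⟨by linarith, h⟩
      have := Real.le_tan h0.le h
      rwa [Real.tan_eq_sin_div_cos, le_div_iff₀ hc] at this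
  have hsq : (y * Real.cos y) ^ 2 ≤ Real.sin y ^ 2 := pow_le_pow_left₀ (by positivity) hle 2
  rw [sub_le_iff_le_add, div_le_iff₀ (by positivity)]
  have h3 : (1 + 1 / y ^ 2) * Real.sin y ^ 2 = Real.sin y ^ 2 + Real.sin y ^ 2 / y ^ 2 := by ring
  have h4 : Real.cos y ^ 2 ≤ Real.sin y ^ 2 / y ^ 2 := by
    rw [le_div_iff₀ (by positivity)]
    linarith
  rw [h3]
  linarith [Real.sin_sq_add_cos_sq y]

/-- On average `sin² ((2j+1)πx)` is `1/2`, up to a sum of cosines which is small unless `x` is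
within `O(1/n)` of `0` or `1/2`; near `1/2` the kernel itself is bounded. -/
lemma abs_dirichletSqAverage_sub_le {n : ℕ} (hn : n ≠ 0) {x : ℝ} (h0 : 0 < x) (h1 : x ≤ 1 / 2) :
    |dirichletSqAverage n x - 1 / (2 * Real.pi ^ 2 * x ^ 2)| ≤
      (5 + min 1 (1 / (n * x)) / x ^ 2) / 2 := by
  have hnpos : (0 : ℝ) < n := by exact_mod_cast Nat.pos_of_ne_zero hn
  have hs := two_mul_le_sin_pi_mul h0.le h1
  have hspos : 0 < Real.sin (Real.pi * x) := by linarith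
  have hpx : 0 < Real.pi * x := by positivity
  set s := Real.sin (Real.pi * x) with hsdef
  set T := ∑ j ∈ Finset.range n, Real.cos ((2 * j + 1) * (2 * (Real.pi * x))) with hT
  have hA : dirichletSqAverage n x - 1 / (2 * Real.pi ^ 2 * x ^ 2) =
      ((1 / s ^ 2 - 1 / (Real.pi * x) ^ 2) - T / n / s ^ 2) / 2 := by
    have hsum : ∑ j ∈ Finset.range n, Real.sin ((2 * j + 1) * (Real.pi * x)) ^ 2 =
        n / 2 - T / 2 := by
      rw [hT, Finset.sum_div]
      have : (n : ℝ) / 2 = ∑ j ∈ Finset.range n, (1 / 2 : ℝ) := by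
        rw [Finset.sum_const, Finset.card_range, nsmul_eq_mul]
        ring
      rw [this, ← Finset.sum_sub_distrib]
      refine Finset.sum_congr rfl fun j _ => ?_
      rw [Real.sin_sq_eq_half_sub]
      congr 3
      ring
    rw [dirichletSqAverage_eq n hspos.ne', hsum, ← hsdef]
    field_simp
    ring
  have hlow : 0 ≤ 1 / s ^ 2 - 1 / (Real.pi * x) ^ 2 := by
    rw [sub_nonneg]
    have := (Real.sin_lt hpx).le
    gcongr
  have hup : 1 / s ^ 2 - 1 / (Real.pi * x) ^ 2 ≤ 1 :=
    inv_sin_sq_sub_inv_sq_le_one hpx (by nlinarith [Real.pi_pos])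
  have hT1 : |T| / n ≤ 1 := by
    refine div_le_one_of_le₀ ?_ hnpos.le
    refine (Finset.abs_sum_le_sum_abs _ _).trans ?_
    refine (Finset.sum_le_card_nsmul _ _ 1 fun k _ => Real.abs_cos_le_one _).trans ?_
    simp
  have hmin : 0 ≤ min 1 (1 / (n * x)) := le_min zero_le_one (by positivity)
  have hTs : |T| / n / s ^ 2 ≤ 4 + min 1 (1 / (n * x)) / x ^ 2 := by
    -- For `x ≤ 1/4` both `sin (πx)` and `sin (2πx)` are of order `x`; for `x ≥ 1/4` the trivial
    -- bound on `T` suffices because `sin (πx) ≥ 1/2`.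
    rcases le_total x (1 / 4) with hx | hx
    · have hs2 := two_mul_le_sin_pi_mul (x := 2 * x) (by linarith) (by linarith)
      have hprod := two_sin_mul_sum_cos n (2 * (Real.pi * x))
      rw [← hT, show 2 * (Real.pi * x) = Real.pi * (2 * x) by ring] at hprod
      have hT2 : |T| ≤ 1 / x := by
        rw [le_div_iff₀ h0]
        have h2 : |2 * Real.sin (Real.pi * (2 * x)) * T| ≤ 1 := by
          rw [hprod]
          exact Real.abs_sin_le_one _
        rw [abs_mul, abs_of_nonneg (by linarith)] at h2
        nlinarith [abs_nonneg T, mul_nonneg (abs_nonneg T) h0.le]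
      have hT3 : |T| / n ≤ 1 / (n * x) := by
        calc |T| / n ≤ 1 / x / n := by gcongr
          _ = _ := by field_simp
      have h3 : |T| / n / s ^ 2 ≤ min 1 (1 / (n * x)) / x ^ 2 :=
        div_le_div₀ hmin (le_min hT1 hT3) (by positivity) (by nlinarith)
      linarith
    · have h3 : |T| / n / s ^ 2 ≤ 4 := by
        rw [div_le_iff₀ (by positivity)]
        nlinarith
      have : 0 ≤ min 1 (1 / (n * x)) / x ^ 2 := by positivity
      linarith
  rw [hA, abs_div, abs_of_pos (show (0 : ℝ) < 2 by norm_num)]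
  gcongr
  refine (abs_sub _ _).trans ?_
  rw [abs_of_nonneg hlow, abs_div, abs_div, abs_of_pos hnpos, abs_of_nonneg (sq_nonneg s)]
  linarith

lemma cos_two_pi_mul_distNearestInt (k : ℕ) (x : ℝ) :
    Real.cos (2 * Real.pi * k * distNearestInt x) = Real.cos (2 * Real.pi * k * x) := by
  rw [distNearestInt, cos_mul_abs,
    ← Real.cos_sub_int_mul_two_pi (2 * Real.pi * k * x) (k * round x)]
  congr 1
  push_cast
  ring

lemma hasSum_dirichletSqAverage {α : ℝ} (hα : Irrational α) {n : ℕ} (hn : n ≠ 0) :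
    HasSum (fun m : ℕ => 1 / (2 * Real.pi ^ 2 * (m : ℝ) ^ 2) *
        dirichletSqAverage n (distNearestInt (m * α)))
      (l2DiscrepancySq (davenportSet n α) - 13 / 36) := by
  have heq : ∀ m : ℕ, dirichletSqAverage n (distNearestInt (m * α)) = (∑ j ∈ Finset.range n,
      (2 * ∑ k ∈ Finset.Icc 1 j, Real.cos (2 * Real.pi * m * (k * α)) + 1) ^ 2) / n := by
    intro m
    refine congrArg (· / (n : ℝ)) (Finset.sum_congr rfl fun j _ => ?_)
    congr 3
    refine Finset.sum_congr rfl fun k _ => ?_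
    rw [cos_two_pi_mul_distNearestInt]
    congr 1
    ring
  simpa only [heq] using hasSum_l2DiscrepancySq_davenportSet hα hn

/-! ### Counting multiples of `α` near the integers -/

/-- If the points `mα` modulo `1` are `ρ`-separated for `m` in an interval, then their distances
from `0` dominate `0, ρ, 2ρ, …`, whence an inverse-square sum over them is `O(ρ⁻²)`. -/
theorem sum_min_inv_sq_le {α ρ : ℝ} (hρ : 0 < ρ) {a b : ℕ}
    (hsep : ∀ h : ℕ, 1 ≤ h → h < b - a → ρ ≤ distNearestInt (h * α)) :
    ∑ m ∈ Finset.Ico a b, min (1 / ρ ^ 2) (1 / distNearestInt (m * α) ^ 2) ≤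
      (1 + 4 * ∑' i : ℤ, 1 / (i : ℝ) ^ 2) / ρ ^ 2 := by
  -- `f m` is the index of the cell `[iρ, (i + 1)ρ)` containing the signed distance of `mα` from the
  -- nearest integer; by separation each cell contains at most one point.
  set f : ℕ → ℤ := fun m => ⌊((m : ℝ) * α - round ((m : ℝ) * α)) / ρ⌋ with hf
  have hle : ∀ m : ℕ, (f m : ℝ) * ρ ≤ (m : ℝ) * α - round ((m : ℝ) * α) := fun m => by
    rw [← le_div_iff₀ hρ]
    exact Int.floor_le _
  have hlt : ∀ m : ℕ, (m : ℝ) * α - round ((m : ℝ) * α) < (f m + 1) * ρ := fun m => by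
    rw [← div_lt_iff₀ hρ]
    exact Int.lt_floor_add_one _
  have hlt_inj : ∀ m ∈ Finset.Ico a b, ∀ m' ∈ Finset.Ico a b, m < m' → f m ≠ f m' := by
    intro m hm m' hm' hmm heq
    rw [Finset.mem_Ico] at hm hm'
    have h1 := hsep (m' - m) (by omega) (by omega)
    have h2 := distNearestInt_le_abs_sub (((m' - m : ℕ) : ℝ) * α)
      (round ((m' : ℝ) * α) - round ((m : ℝ) * α))
    rw [Nat.cast_sub hmm.le] at h1 h2
    have h3 : |((m' : ℝ) - m) * α -
        ((round ((m' : ℝ) * α) - round ((m : ℝ) * α) : ℤ) : ℝ)| < ρ := by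
      have h4 := hle m
      have h5 := hlt m
      rw [heq] at h4 h5
      have h6 := hle m'
      have h7 := hlt m'
      rw [abs_lt]
      push_cast
      constructor <;> linarith
    linarith
  have hinj : Set.InjOn f (Finset.Ico a b : Finset ℕ) := by
    intro m hm m' hm' heq
    rcases lt_trichotomy m m' with h | h | h
    · exact absurd heq (hlt_inj m hm m' hm' h)
    · exact h
    · exact absurd heq.symm (hlt_inj m' hm' m hm h)
  set g : ℤ → ℝ := fun i => (if i = 0 then 1 else 0) + 4 * (1 / (i : ℝ) ^ 2) with hg
  have hterm : ∀ m : ℕ, min (1 / ρ ^ 2) (1 / distNearestInt (m * α) ^ 2) ≤ g (f m) / ρ ^ 2 := by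
    intro m
    by_cases hi0 : f m = 0
    · refine (min_le_left _ _).trans (le_of_eq ?_)
      simp [hg, hi0]
    have hgf : g (f m) = 4 / (f m : ℝ) ^ 2 := by
      simp only [hg, hi0, if_false]
      ring
    rw [hgf]
    have key : (f m : ℝ) ^ 2 * ρ ^ 2 ≤ 4 * distNearestInt (m * α) ^ 2 →
        min (1 / ρ ^ 2) (1 / distNearestInt (m * α) ^ 2) ≤ 4 / (f m : ℝ) ^ 2 / ρ ^ 2 := by
      intro hsq
      refine (min_le_right _ _).trans ?_
      have hpos : 0 < (f m : ℝ) ^ 2 * ρ ^ 2 := by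
        have : (f m : ℝ) ≠ 0 := by exact_mod_cast hi0
        positivity
      rw [div_div, div_le_div_iff₀ (by linarith) hpos]
      linarith
    have hd2 : distNearestInt (m * α) ^ 2 = ((m : ℝ) * α - round ((m : ℝ) * α)) ^ 2 := by
      rw [distNearestInt, sq_abs]
    have h4 := hle m
    have h5 := hlt m
    -- Outside the two cells adjacent to `0` the distance is at least `|f m| ρ / 2`.
    rcases lt_trichotomy (f m) (-1) with h | h | h
    · have h' : (f m : ℝ) ≤ -2 := by exact_mod_cast (by omega : f m ≤ -2)
      have h6 : 2 * ((m : ℝ) * α - round ((m : ℝ) * α)) ≤ f m * ρ := by nlinarith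
      have h7 : (f m : ℝ) * ρ ≤ 0 := mul_nonpos_of_nonpos_of_nonneg (by linarith) hρ.le
      apply key
      rw [hd2]
      nlinarith [mul_nonneg (sub_nonneg.2 h6) (neg_nonneg.2 (add_nonpos h7 (h6.trans h7)))]
    · refine (min_le_left _ _).trans ?_
      rw [h]
      gcongr
      norm_num
    · have h' : (1 : ℝ) ≤ f m := by exact_mod_cast (by omega : 1 ≤ f m)
      apply key
      rw [hd2]
      nlinarith [mul_nonneg (zero_le_one.trans h') hρ.le]
  calc _ ≤ ∑ m ∈ Finset.Ico a b, g (f m) / ρ ^ 2 := Finset.sum_le_sum fun m _ => hterm m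
    _ = (∑ i ∈ (Finset.Ico a b).image f, g i) / ρ ^ 2 := by
      rw [Finset.sum_image hinj, Finset.sum_div]
    _ ≤ _ := by
      gcongr
      rw [hg, Finset.sum_add_distrib, ← Finset.mul_sum]
      gcongr
      · rw [Finset.sum_ite_eq']
        split_ifs <;> norm_num
      · exact (Real.summable_one_div_int_pow.2 (by norm_num)).sum_le_tsum _
          fun i _ => by positivity

lemma sum_min_one_geometric_le {X : ℝ} (hX : 1 ≤ X) (N : ℕ) :
    ∑ i ∈ Finset.range N, min 1 (X / 2 ^ i) ≤ 2 * Real.log X + 3 := by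
  -- The first `p` terms are bounded by `1`, the others by a geometric series.
  set p := ⌈Real.logb 2 X⌉₊ with hp
  have hXp : X ≤ 2 ^ p := by
    have h := Nat.le_ceil (Real.logb 2 X)
    rwa [Real.logb_le_iff_le_rpow (by norm_num) (by linarith), Real.rpow_natCast] at h
  have hp' : (p : ℝ) ≤ 2 * Real.log X + 1 := by
    have h := (Nat.ceil_lt_add_one (Real.logb_nonneg (by norm_num : (1 : ℝ) < 2) hX)).le
    refine h.trans ?_
    gcongr
    rw [Real.logb, div_le_iff₀ (Real.log_pos (by norm_num))]
    nlinarith [Real.log_nonneg hX, Real.log_two_gt_d9]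
  have hpos : ∀ i : ℕ, 0 ≤ min 1 (X / 2 ^ i) := fun i => le_min zero_le_one (by positivity)
  calc _ ≤ ∑ i ∈ Finset.range (p + N), min 1 (X / 2 ^ i) :=
        Finset.sum_le_sum_of_subset_of_nonneg (Finset.range_mono (by omega)) fun i _ _ => hpos i
    _ = ∑ i ∈ Finset.range p, min 1 (X / 2 ^ i) +
        ∑ i ∈ Finset.range N, min 1 (X / 2 ^ (p + i)) := Finset.sum_range_add _ _ _
    _ ≤ p + 2 := by
      gcongr
      · refine (Finset.sum_le_card_nsmul _ _ 1 fun i _ => min_le_left _ _).trans ?_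
        simp
      · refine le_trans (Finset.sum_le_sum fun i _ => ?_) (sum_geometric_two_le N)
        refine (min_le_right _ _).trans ?_
        rw [pow_add, ← div_div, one_div_pow]
        gcongr
        exact div_le_one_of_le₀ hXp (by positivity)
    _ ≤ _ := by linarith

/-! ### Sums over the frequencies -/

/-- A constant bounding the sums in `sum_min_inv_sq_le`. -/
noncomputable def inverseSquareConst : ℝ := 1 + 4 * ∑' i : ℤ, 1 / (i : ℝ) ^ 2

lemma inverseSquareConst_pos : 0 < inverseSquareConst := by
  have : 0 ≤ ∑' i : ℤ, 1 / (i : ℝ) ^ 2 := tsum_nonneg fun i => by positivity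
  unfold inverseSquareConst
  linarith

/-- The contribution of one dyadic block of frequencies. -/
lemma sum_dyadic_block_le {α c L : ℝ} (hc : 0 < c) (hL : 1 ≤ L) {n : ℕ}
    (hdio : ∀ m : ℕ, 1 ≤ m → m ≤ n → c / (m * L) ≤ distNearestInt (m * α)) {j : ℕ}
    (hj : 2 ^ j ≤ n) :
    ∑ m ∈ Finset.Ico (2 ^ j) (min (2 ^ (j + 1)) (n + 1)),
      min 1 (1 / (n * distNearestInt (m * α))) / ((m : ℝ) ^ 2 * distNearestInt (m * α) ^ 2) ≤
      4 * inverseSquareConst * L ^ 2 / c ^ 2 * min 1 (2 ^ (j + 1) * L / (c * n)) := by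
  have hL0 : 0 < L := by linarith
  have h2j : (0 : ℝ) < 2 ^ j := by positivity
  have hnpos : (0 : ℝ) < n := by
    exact_mod_cast (Nat.pos_of_ne_zero fun h => by simp [h] at hj)
  set ρ := c / (2 ^ (j + 1) * L) with hρ
  have hρpos : 0 < ρ := by positivity
  have hle : ∀ m : ℕ, 1 ≤ m → m ≤ n → m ≤ 2 ^ (j + 1) → ρ ≤ distNearestInt (m * α) := by
    intro m h1 hn h2
    refine le_trans ?_ (hdio m h1 hn)
    have hm : (0 : ℝ) < m := by exact_mod_cast h1
    have h2' : (m : ℝ) ≤ 2 ^ (j + 1) := by exact_mod_cast h2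
    rw [hρ]
    gcongr
  have hcount := sum_min_inv_sq_le (α := α) hρpos (a := 2 ^ j)
    (b := min (2 ^ (j + 1)) (n + 1)) fun h h1 h2 => hle h h1 (by omega) (by omega)
  have hterm : ∀ m ∈ Finset.Ico (2 ^ j) (min (2 ^ (j + 1)) (n + 1)),
      min 1 (1 / (n * distNearestInt (m * α))) / ((m : ℝ) ^ 2 * distNearestInt (m * α) ^ 2) ≤
      min 1 (2 ^ (j + 1) * L / (c * n)) / (2 ^ j) ^ 2 *
        min (1 / ρ ^ 2) (1 / distNearestInt (m * α) ^ 2) := by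
    intro m hm
    rw [Finset.mem_Ico, lt_min_iff] at hm
    have hm1 : 1 ≤ m := (Nat.one_le_two_pow).trans hm.1
    have hδ := hle m hm1 (by omega) (by omega)
    have hδpos := hρpos.trans_le hδ
    have hm' : (2 : ℝ) ^ j ≤ m := by exact_mod_cast hm.1
    rw [min_eq_right (show 1 / distNearestInt (m * α) ^ 2 ≤ 1 / ρ ^ 2 by gcongr),
      ← div_div, div_eq_mul_one_div _ (distNearestInt (m * α) ^ 2)]
    have hmin : min 1 (1 / (n * distNearestInt (m * α))) ≤ min 1 (2 ^ (j + 1) * L / (c * n)) := by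
      refine min_le_min le_rfl ?_
      calc 1 / (n * distNearestInt (m * α)) ≤ 1 / (n * ρ) := by gcongr
        _ = _ := by
          rw [hρ]
          field_simp
    have hnn : 0 ≤ min 1 (2 ^ (j + 1) * L / (c * n)) := le_min zero_le_one (by positivity)
    gcongr
  refine (Finset.sum_le_sum hterm).trans ?_
  rw [← Finset.mul_sum]
  have hnn : 0 ≤ min 1 (2 ^ (j + 1) * L / (c * n)) := le_min zero_le_one (by positivity)
  calc _ ≤ min 1 (2 ^ (j + 1) * L / (c * n)) / (2 ^ j) ^ 2 * (inverseSquareConst / ρ ^ 2) := by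
        gcongr
        exact hcount
    _ = _ := by
        rw [hρ, pow_succ]
        field_simp
        ring

/-- The weighted sum over all `m ≤ n`: the factor `min 1 (2 ^ (j + 1) L / (cn))` of the `j`-th
dyadic block decays geometrically below the top `O(log (L / c))` blocks. -/
theorem sum_frequencies_le {α c L : ℝ} (hc : 0 < c) (hc1 : c ≤ 1) (hL : 1 ≤ L) {n : ℕ}
    (hn : n ≠ 0)
    (hdio : ∀ m : ℕ, 1 ≤ m → m ≤ n → c / (m * L) ≤ distNearestInt (m * α)) :
    ∑ m ∈ Finset.Icc 1 n,
      min 1 (1 / (n * distNearestInt (m * α))) / ((m : ℝ) ^ 2 * distNearestInt (m * α) ^ 2) ≤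
      4 * inverseSquareConst * L ^ 2 / c ^ 2 * (2 * Real.log (2 * L / c) + 3) := by
  have hL0 : 0 < L := by linarith
  have hnpos : (0 : ℝ) < n := by exact_mod_cast Nat.pos_of_ne_zero hn
  have hK := inverseSquareConst_pos
  set J := Nat.log 2 n with hJ
  have hmaps : ∀ m ∈ Finset.Icc 1 n, Nat.log 2 m ∈ Finset.range (J + 1) := by
    intro m hm
    rw [Finset.mem_range, Nat.lt_succ_iff]
    exact Nat.log_mono_right (Finset.mem_Icc.1 hm).2
  rw [← Finset.sum_fiberwise_of_maps_to hmaps]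
  have hblock : ∀ j ∈ Finset.range (J + 1), ∑ m ∈ Finset.Icc 1 n with Nat.log 2 m = j,
      min 1 (1 / (n * distNearestInt (m * α))) / ((m : ℝ) ^ 2 * distNearestInt (m * α) ^ 2) ≤
      4 * inverseSquareConst * L ^ 2 / c ^ 2 * min 1 (2 * L / c / 2 ^ (J + 1 - 1 - j)) := by
    intro j hj
    rw [Finset.mem_range, Nat.lt_succ_iff] at hj
    have h2J : 2 ^ J ≤ n := Nat.pow_log_le_self 2 hn
    have h2j : 2 ^ j ≤ n := (Nat.pow_le_pow_right (by norm_num) hj).trans h2J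
    refine le_trans (Finset.sum_le_sum_of_subset_of_nonneg ?_ fun m _ _ => ?_)
      ((sum_dyadic_block_le hc hL hdio h2j).trans ?_)
    · intro m hm
      rw [Finset.mem_filter, Finset.mem_Icc] at hm
      obtain ⟨⟨h1, h2⟩, h3⟩ := hm
      rw [Finset.mem_Ico, lt_min_iff, ← h3]
      exact ⟨Nat.pow_log_le_self 2 (by omega), Nat.lt_pow_succ_log_self (by norm_num) m, by omega⟩
    · exact div_nonneg (le_min zero_le_one
        (div_nonneg zero_le_one (mul_nonneg hnpos.le (distNearestInt_nonneg _)))) (by positivity)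
    · have h2J' : (2 : ℝ) ^ J ≤ n := by exact_mod_cast h2J
      have : (2 : ℝ) ^ (j + 1) * L / (c * n) ≤ 2 * L / c / 2 ^ (J + 1 - 1 - j) := by
        calc (2 : ℝ) ^ (j + 1) * L / (c * n) ≤ 2 ^ (j + 1) * L / (c * 2 ^ J) := by gcongr
          _ = _ := by
            have hpow : (2 : ℝ) ^ J = 2 ^ (J - j) * 2 ^ j := by
              rw [← pow_add, Nat.sub_add_cancel hj]
            rw [Nat.add_sub_cancel, hpow, pow_succ]
            field_simp
      gcongr
  refine (Finset.sum_le_sum hblock).trans ?_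
  rw [← Finset.mul_sum, Finset.sum_range_reflect (fun i => min 1 (2 * L / c / 2 ^ i))]
  gcongr
  refine sum_min_one_geometric_le ?_ _
  rw [le_div_iff₀ hc]
  linarith

/-- The tail of the series for the discrepancy, split into blocks of `n` consecutive
frequencies. -/
theorem tsum_tail_le {α c L : ℝ} (hα : Irrational α) (hc : 0 < c) (hc1 : c ≤ 1) (hL : 1 ≤ L)
    {n : ℕ} (hn : n ≠ 0)
    (hdio : ∀ m : ℕ, 1 ≤ m → m ≤ n → c / (m * L) ≤ distNearestInt (m * α)) :
    ∑' i : ℕ, 1 / (2 * Real.pi ^ 2 * ((i + (n + 1) : ℕ) : ℝ) ^ 2) *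
        dirichletSqAverage n (distNearestInt ((i + (n + 1) : ℕ) * α)) ≤
      2 * inverseSquareConst * L ^ 2 / c ^ 2 := by
  have hL0 : 0 < L := by linarith
  have hK := inverseSquareConst_pos
  have hnpos : (0 : ℝ) < n := by exact_mod_cast Nat.pos_of_ne_zero hn
  set F : ℕ → ℝ := fun m => 1 / (2 * Real.pi ^ 2 * (m : ℝ) ^ 2) *
        dirichletSqAverage n (distNearestInt (m * α)) with hF
  have hFnn : ∀ m, 0 ≤ F m := fun m =>
    mul_nonneg (by positivity) (dirichletSqAverage_nonneg _ _)
  set ρ := c / (n * L) with hρ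
  have hρpos : 0 < ρ := by positivity
  have hρn : ρ ≤ 1 / n := by
    rw [hρ, div_le_div_iff₀ (by positivity) hnpos]
    nlinarith
  have hFle : ∀ m : ℕ, m ≠ 0 →
      F m ≤ 1 / (m : ℝ) ^ 2 * min (1 / ρ ^ 2) (1 / distNearestInt (m * α) ^ 2) := by
    intro m hm
    have hm' : (m : ℝ) ≠ 0 := by exact_mod_cast hm
    have hδ := distNearestInt_nat_mul_pos hα hm
    have h1 : dirichletSqAverage n (distNearestInt (m * α)) ≤
        4 * min (1 / ρ ^ 2) (1 / distNearestInt (m * α) ^ 2) := by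
      rw [mul_min_of_nonneg _ _ (by norm_num)]
      refine le_min ((dirichletSqAverage_le_sq _ _).trans ?_)
        ((dirichletSqAverage_le_inv_sq n hδ (distNearestInt_le_half _)).trans ?_)
      · gcongr
        rw [le_div_iff₀ (by positivity)]
        have : (n : ℝ) * ρ ≤ 1 := by
          calc (n : ℝ) * ρ ≤ n * (1 / n) := by gcongr
            _ = 1 := by field_simp
        rw [← mul_pow]
        exact pow_le_one₀ (by positivity) this
      · rw [mul_one_div]
        exact div_le_div₀ (by norm_num) (by norm_num) (by positivity)
          (by linarith [sq_nonneg (distNearestInt (m * α))])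
    have hmin : 0 ≤ min (1 / ρ ^ 2) (1 / distNearestInt (m * α) ^ 2) :=
      le_min (by positivity) (by positivity)
    calc F m ≤ 1 / (2 * Real.pi ^ 2 * (m : ℝ) ^ 2) *
          (4 * min (1 / ρ ^ 2) (1 / distNearestInt (m * α) ^ 2)) :=
          mul_le_mul_of_nonneg_left h1 (by positivity)
      _ = 2 / Real.pi ^ 2 * (1 / (m : ℝ) ^ 2 *
          min (1 / ρ ^ 2) (1 / distNearestInt (m * α) ^ 2)) := by
          field_simp
          ring
      _ ≤ 1 * (1 / (m : ℝ) ^ 2 * min (1 / ρ ^ 2) (1 / distNearestInt (m * α) ^ 2)) := by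
          gcongr
          rw [div_le_one (by positivity)]
          nlinarith [Real.pi_gt_three]
      _ = _ := one_mul _
  have hblock : ∀ b : ℕ, ∑ i ∈ Finset.range n, F (b * n + i + (n + 1)) ≤
      inverseSquareConst * L ^ 2 / c ^ 2 * (1 / ((b + 1 : ℕ) : ℝ) ^ 2) := by
    intro b
    have hcount := sum_min_inv_sq_le (α := α) hρpos (a := b * n + (n + 1))
      (b := b * n + (n + 1) + n) fun h h1 h2 => by
        refine le_trans ?_ (hdio h h1 (by omega))
        have hh : (0 : ℝ) < h := by exact_mod_cast h1
        have hh' : (h : ℝ) ≤ n := by exact_mod_cast (by omega : h ≤ n)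
        rw [hρ]
        gcongr
    rw [Finset.sum_Ico_eq_sum_range, Nat.add_sub_cancel_left] at hcount
    have hterm : ∀ i ∈ Finset.range n, F (b * n + i + (n + 1)) ≤ 1 / (((b + 1 : ℕ) : ℝ) * n) ^ 2 *
        min (1 / ρ ^ 2) (1 / distNearestInt (((b * n + (n + 1) + i : ℕ) : ℝ) * α) ^ 2) := by
      intro i _
      rw [show b * n + i + (n + 1) = b * n + (n + 1) + i by ring]
      refine (hFle _ (by omega)).trans ?_
      have hmin : 0 ≤ min (1 / ρ ^ 2)
          (1 / distNearestInt (((b * n + (n + 1) + i : ℕ) : ℝ) * α) ^ 2) :=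
        le_min (by positivity) (by positivity)
      have hle : ((b + 1 : ℕ) : ℝ) * n ≤ ((b * n + (n + 1) + i : ℕ) : ℝ) := by
        have : (b + 1) * n ≤ b * n + (n + 1) + i := by
          rw [add_mul]
          omega
        exact_mod_cast this
      gcongr
    refine (Finset.sum_le_sum hterm).trans ?_
    rw [← Finset.mul_sum]
    calc _ ≤ 1 / (((b + 1 : ℕ) : ℝ) * n) ^ 2 * (inverseSquareConst / ρ ^ 2) := by
          gcongr
          exact hcount
      _ = _ := by
          rw [hρ]
          field_simp
  have hpartial : ∀ M : ℕ, ∑ i ∈ Finset.range (M * n), F (i + (n + 1)) ≤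
      ∑ b ∈ Finset.range M, inverseSquareConst * L ^ 2 / c ^ 2 * (1 / ((b + 1 : ℕ) : ℝ) ^ 2) := by
    intro M
    induction M with
    | zero => simp
    | succ M ih =>
      rw [add_mul, one_mul, Finset.sum_range_add, Finset.sum_range_succ]
      exact add_le_add ih (hblock M)
  have hzeta : ∀ M : ℕ, ∑ b ∈ Finset.range M, 1 / ((b + 1 : ℕ) : ℝ) ^ 2 ≤ 2 := by
    intro M
    have h1 := sum_le_hasSum (Finset.range (M + 1)) (fun i _ => by positivity) hasSum_zeta_two
    rw [Finset.sum_range_succ'] at h1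
    have : Real.pi ^ 2 / 6 ≤ 2 := by nlinarith [Real.pi_lt_d2, Real.pi_pos]
    simp only [Nat.cast_zero, ne_eq, OfNat.ofNat_ne_zero, not_false_eq_true, zero_pow, div_zero,
      add_zero] at h1
    linarith
  refine Real.tsum_le_of_sum_range_le (fun i => hFnn _) fun M => ?_
  calc _ ≤ ∑ i ∈ Finset.range (M * n), F (i + (n + 1)) :=
        Finset.sum_le_sum_of_subset_of_nonneg
          (Finset.range_mono (Nat.le_mul_of_pos_right M (Nat.pos_of_ne_zero hn)))
          fun i _ _ => hFnn _
    _ ≤ _ := hpartial M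
    _ ≤ inverseSquareConst * L ^ 2 / c ^ 2 * 2 := by
        rw [← Finset.mul_sum]
        gcongr
        exact hzeta M
    _ = _ := by ring

/-! ### The asymptotic formula -/

lemma sum_Icc_one_div_sq_le_two (n : ℕ) : ∑ m ∈ Finset.Icc 1 n, 1 / (m : ℝ) ^ 2 ≤ 2 := by
  refine (sum_le_hasSum _ (fun i _ => by positivity) hasSum_zeta_two).trans ?_
  nlinarith [Real.pi_lt_d2, Real.pi_pos]

/-- A single frequency `m ≤ n` contributes the corresponding term of the main sum, up to a
manageable error. -/
lemma abs_frequency_sub_main_le {α : ℝ} (hα : Irrational α) {n m : ℕ} (hn : n ≠ 0) (hm : m ≠ 0) :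
    |1 / (2 * Real.pi ^ 2 * (m : ℝ) ^ 2) * dirichletSqAverage n (distNearestInt (m * α)) -
      1 / (4 * Real.pi ^ 4 * (m : ℝ) ^ 2 * distNearestInt (m * α) ^ 2)| ≤
      1 / (m : ℝ) ^ 2 + min 1 (1 / (n * distNearestInt (m * α))) /
        ((m : ℝ) ^ 2 * distNearestInt (m * α) ^ 2) := by
  have hδ := distNearestInt_nat_mul_pos hα hm
  have hm' : (0 : ℝ) < m := by exact_mod_cast Nat.pos_of_ne_zero hm
  have hnpos : (0 : ℝ) < n := by exact_mod_cast Nat.pos_of_ne_zero hn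
  have h := abs_dirichletSqAverage_sub_le hn hδ (distNearestInt_le_half _)
  set δ := distNearestInt (m * α)
  have hmin : 0 ≤ min 1 (1 / (n * δ)) := le_min zero_le_one (by positivity)
  have heq : 1 / (2 * Real.pi ^ 2 * (m : ℝ) ^ 2) * dirichletSqAverage n δ -
      1 / (4 * Real.pi ^ 4 * (m : ℝ) ^ 2 * δ ^ 2) =
      1 / (2 * Real.pi ^ 2 * (m : ℝ) ^ 2) *
        (dirichletSqAverage n δ - 1 / (2 * Real.pi ^ 2 * δ ^ 2)) := by
    field_simp
    ring
  rw [heq, abs_mul, abs_of_nonneg (by positivity)]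
  have hrest : 0 ≤ min 1 (1 / (n * δ)) / δ ^ 2 := by positivity
  calc _ ≤ 1 / (2 * Real.pi ^ 2 * (m : ℝ) ^ 2) * ((5 + min 1 (1 / (n * δ)) / δ ^ 2) / 2) := by
        gcongr
    _ = 1 / (4 * Real.pi ^ 2) * (5 + min 1 (1 / (n * δ)) / δ ^ 2) / (m : ℝ) ^ 2 := by
        field_simp
        ring
    _ ≤ 1 / 5 * (5 + min 1 (1 / (n * δ)) / δ ^ 2) / (m : ℝ) ^ 2 := by
        gcongr
        nlinarith [Real.pi_gt_three]
    _ ≤ (1 + min 1 (1 / (n * δ)) / δ ^ 2) / (m : ℝ) ^ 2 := by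
        gcongr
        linarith
    _ = _ := by
        field_simp

/-- The explicit error bound, with `L` in the role of `(log n) ^ d`. -/
theorem abs_l2DiscrepancySq_sub_main_le {α c L : ℝ} (hα : Irrational α) (hc : 0 < c) (hc1 : c ≤ 1)
    (hL : 1 ≤ L) {n : ℕ} (hn : n ≠ 0)
    (hdio : ∀ m : ℕ, 1 ≤ m → m ≤ n → c / (m * L) ≤ distNearestInt (m * α)) :
    |l2DiscrepancySq (davenportSet n α) - ∑ m ∈ Finset.Icc 1 n,
        1 / (4 * Real.pi ^ 4 * (m : ℝ) ^ 2 * distNearestInt ((m : ℝ) * α) ^ 2)| ≤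
      3 + 4 * inverseSquareConst * L ^ 2 / c ^ 2 * (2 * Real.log (2 * L / c) + 3) +
        2 * inverseSquareConst * L ^ 2 / c ^ 2 := by
  have hsum := hasSum_dirichletSqAverage hα hn
  have htail := tsum_tail_le hα hc hc1 hL hn hdio
  have hmid := sum_frequencies_le hc hc1 hL hn hdio
  set F : ℕ → ℝ := fun m => 1 / (2 * Real.pi ^ 2 * (m : ℝ) ^ 2) *
        dirichletSqAverage n (distNearestInt (m * α)) with hF
  have hFnn : ∀ m, 0 ≤ F m := fun m =>
    mul_nonneg (by positivity) (dirichletSqAverage_nonneg _ _)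
  have hsplit := hsum.summable.sum_add_tsum_nat_add (n + 1)
  have hF0 : F 0 = 0 := by simp [hF]
  have hIcc : ∑ i ∈ Finset.range (n + 1), F i = ∑ m ∈ Finset.Icc 1 n, F m := by
    rw [Finset.range_eq_Ico, Finset.sum_eq_sum_Ico_succ_bot (Nat.succ_pos n), hF0, zero_add]
    rfl
  rw [hsum.tsum_eq, hIcc] at hsplit
  have htail0 : 0 ≤ ∑' i, F (i + (n + 1)) := tsum_nonneg fun i => hFnn _
  have hmain : |∑ m ∈ Finset.Icc 1 n, F m - ∑ m ∈ Finset.Icc 1 n,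
        1 / (4 * Real.pi ^ 4 * (m : ℝ) ^ 2 * distNearestInt ((m : ℝ) * α) ^ 2)| ≤
      2 + 4 * inverseSquareConst * L ^ 2 / c ^ 2 * (2 * Real.log (2 * L / c) + 3) := by
    rw [← Finset.sum_sub_distrib]
    refine (Finset.abs_sum_le_sum_abs _ _).trans ((Finset.sum_le_sum fun m hm =>
      abs_frequency_sub_main_le hα hn (by have := (Finset.mem_Icc.1 hm).1; omega)).trans ?_)
    rw [Finset.sum_add_distrib]
    exact add_le_add (sum_Icc_one_div_sq_le_two n) hmid
  have htail' : ∑' i, F (i + (n + 1)) ≤ 2 * inverseSquareConst * L ^ 2 / c ^ 2 := htail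
  rw [abs_le] at hmain ⊢
  constructor <;> linarith [hmain.1, hmain.2]

theorem theorem1 (α : ℝ) (hα : Irrational α) (d : ℝ) (hd : 0 ≤ d)
    (ha : (fun k : ℕ => partialQuotient α k) =O[atTop] fun k : ℕ => (k : ℝ) ^ d) :
    (fun n : ℕ => l2DiscrepancySq (davenportSet n α) -
        ∑ m ∈ Finset.Icc 1 n,
          1 / (4 * Real.pi ^ 4 * (m : ℝ) ^ 2 * distNearestInt ((m : ℝ) * α) ^ 2))
      =O[atTop] fun n : ℕ => Real.log n ^ (2 * d) * Real.log (Real.log n) := by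
  obtain ⟨c, hc, hc1, hdio⟩ := exists_le_distNearestInt hα hd ha
  set K := inverseSquareConst with hKdef
  have hK : 0 < K := inverseSquareConst_pos
  refine IsBigO.of_bound
    (3 + 4 * K / c ^ 2 * (2 * (Real.log (2 / c) + d) + 3) + 2 * K / c ^ 2) ?_
  have hloglog : Tendsto (fun n : ℕ => Real.log (Real.log n)) atTop atTop :=
    Real.tendsto_log_atTop.comp (Real.tendsto_log_atTop.comp tendsto_natCast_atTop_atTop)
  filter_upwards [hloglog.eventually_ge_atTop 1, eventually_ge_atTop 3] with n hll hn
  have hnpos : (0 : ℝ) < n := by exact_mod_cast (by omega : 0 < n)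
  have hlog : 1 ≤ Real.log n := by
    rw [Real.le_log_iff_exp_le hnpos]
    exact Real.exp_one_lt_three.le.trans (by exact_mod_cast hn)
  have hlog0 : 0 < Real.log n := by linarith
  have hL : 1 ≤ Real.log n ^ d := Real.one_le_rpow hlog hd
  have hlogL : Real.log (Real.log n ^ d) = d * Real.log (Real.log n) := Real.log_rpow hlog0 d
  have hsq : Real.log n ^ (2 * d) = (Real.log n ^ d) ^ 2 := by
    rw [mul_comm, ← Real.rpow_mul_natCast hlog0.le]
    norm_num
  have h := abs_l2DiscrepancySq_sub_main_le hα hc hc1 hL (by omega) (hdio n hn)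
  rw [hsq, Real.norm_eq_abs, Real.norm_of_nonneg (by positivity)]
  refine h.trans ?_
  rw [← hKdef, mul_div_right_comm 2 (Real.log n ^ d) c, Real.log_mul (by positivity) (by positivity),
    hlogL]
  set L := Real.log n ^ d
  set ℓ := Real.log (Real.log n)
  have hlc : 0 ≤ Real.log (2 / c) := Real.log_nonneg (by rw [le_div_iff₀ hc]; linarith)
  have hL2 : 1 ≤ L ^ 2 := one_le_pow₀ hL
  have hone : 1 ≤ L ^ 2 * ℓ := by nlinarith
  have h1 : 2 * (Real.log (2 / c) + d * ℓ) + 3 ≤ (2 * (Real.log (2 / c) + d) + 3) * ℓ := by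
    nlinarith
  calc _ ≤ 3 * (L ^ 2 * ℓ) + 4 * K * L ^ 2 / c ^ 2 * ((2 * (Real.log (2 / c) + d) + 3) * ℓ) +
        2 * K * L ^ 2 / c ^ 2 * ℓ := by
        gcongr
        · linarith
        · exact le_mul_of_one_le_right (by positivity) hll
    _ = _ := by ring
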